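/- **Setting.** Let $\mathbb U$ be a standard Borel space (the universe). A schema $\tau$ consists of finitely many relation symbols $R$, each with an arity and with a measurable domain $\subseteq\mathbb U$ for each attribute. A fact $R(a_1,\dots,a_k)$ over $\tau$ has each $a_i$ in the domain of the $i$th attribute of $R$; the set $\mathbb F_\tau$ of facts carries the $\sigma$-algebra obtained from $\mathbb U$ by finite products and disjoint unions. $\mathbb{DB}^{\rm bag}_\tau$ is the set of finite bags of facts, with the counting $\sigma$-algebra $\mathfrak C_\tau$ generated by the sets $\{B : |B|_F=n\}$ ($F\subseteq\mathbb F_\tau$ measurable, $n\in\mathbb N$), where $|B|_F$ counts the elements of $F$ in $B$ with multiplicity. A *standard sub-probabilistic database* over $\tau$ is a measure $P$ on $(\mathbb{DB}^{\rm bag}_\tau,\mathfrak C_\tau)$ of total mass at most $1$. **Programs.** Let $\Psi$ be a family of parametrised distributions, that is, Markov kernels from a measurable set of parameter tuples over $\mathbb U$ to $\mathbb U$, each concentrated on a given measurable range (discrete, continuous or deterministic). $\Psi$-terms are built from variables and constants by applying members of $\Psi$ to terms; under an assignment of its variables, a well-typed term denotes a probability distribution (arguments are sampled independently and used as parameters).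 A GDatalog program $\mathcal G$ with extensional schema $E$ and intensional schema $I$ is a finite bag of rules $R(t_1,\dots,t_k)\gets S_1(\bar x_1),\dots,S_m(\bar x_m)$, where the body consists of atoms over $E$ and $I$ with variables as arguments, $R$ belongs to $I$, all variables of the $\Psi$-terms $t_i$ appear in the body, and the terms are well-typed, the range of $t_i$ being contained in the domain of the $i$th attribute of $R$. **Runs.** Let $D$ be a finite set of facts over $E$. A history is a finite sequence of rule applications (an occurrence of a rule with an assignment $\alpha$ of its variables), each with the intensional fact it generated. After a history, a rule occurrence with an assignment $\alpha$ is applicable if all body atoms hold under $\alpha$ in $D$ together with the facts generated so far and this occurrence has not yet been applied with the same instantiation of the variables appearing in its head. Applying it generates the fact $R(a_1,\dots,a_k)$ with $a_1,\dots,a_k$ sampled independently of each other, and independently of the past given $\alpha$, from the distributions of $t_1,\dots,t_k$ under $\alpha$. A history is terminal if nothing is applicable. A policy selects, for each non-terminal history, an applicable rule occurrence with assignment; it is measurable if this selection is a measurable function. Under a policy, the run starts with the empty history; in each step the selected rule is applied, and terminal histories stay unchanged. If a terminal history is reached, the run terminates, and its output is the set of generated facts. **Theorem.** For every GDatalog program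 $\mathcal G$ and every database instance $D$ over the extensional schema, measurable policies exist, and there is a unique standard sub-probabilistic database $\mathcal G(D)$ over the intensional schema $I$, concentrated on set instances, such that for *every* measurable policy: 1. the one-step transition law of the run is a Markov kernel on the space of histories, and there is exactly one probability measure $\mu$ on infinite sequences of histories that is the law of the run; 2. for every $C\in\mathfrak C_I$, the event "the run terminates with an output in $C$" is measurable, and its probability under $\mu$ is $\mathcal G(D)(C)$. In particular, $\mathcal G(D)$ does not depend on the order in which the rules are applied, as long as the policy is measurable. -/

import Mathlib

open MeasureTheory ProbabilityTheory

noncomputable section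

namespace GDatalog

universe u w

/-! ### Schemas, facts, instances -/

/-- A database schema over the universe `U`: finitely many relation symbols, each with an arity and
with a measurable domain for each of its attributes. -/
structure Schema (U : Type u) [MeasurableSpace U] where
  Rel : Type
  [finite : Finite Rel]
  arity : Rel → ℕ
  dom : (R : Rel) → Fin (arity R) → Set U
  measurableSet_dom : ∀ R i, MeasurableSet (dom R i)

/-- Facts `R(a₁, …, a_k)`, with the σ-algebra obtained from that of `U` by
subspaces, finite products and disjoint unions. -/
abbrev Fact {U : Type u} [MeasurableSpace U] (τ : Schema U) : Type u :=
  Σ R : τ.Rel, ((i : Fin (τ.arity R)) → τ.dom R i)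

/-- Bag instances: finite bags of facts. -/
def BagInstance {U : Type u} [MeasurableSpace U] (τ : Schema U) : Type u :=
  Multiset (Fact τ)

/-- `|D|_F`, the number of elements of `F` in `D`, counted with multiplicity. -/
def BagInstance.count {U : Type u} [MeasurableSpace U] {τ : Schema U} (D : BagInstance τ)
    (F : Set (Fact τ)) : ℕ :=
  open Classical in Multiset.countP (fun f => f ∈ F) D

/-- The counting σ-algebra, generated by the counting events `#(F, n)`. -/
instance BagInstance.instMeasurableSpace {U : Type u} [MeasurableSpace U] (τ : Schema U) :
    MeasurableSpace (BagInstance τ) :=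
  MeasurableSpace.generateFrom
    {S | ∃ (F : Set (Fact τ)) (n : ℕ), MeasurableSet F ∧ S = {D | D.count F = n}}

/-- The bag instances without duplicates, that is, the set instances. -/
def BagInstance.IsSet {U : Type u} [MeasurableSpace U] {τ : Schema U} (D : BagInstance τ) : Prop :=
  Multiset.Nodup D

/-! ### Parametrised distributions and terms -/

/-- A parametrised distribution on `U`: a Markov kernel from a measurable set of
parameter tuples to `U` whose values lie in a given measurable range. Deterministic measurable
functions are the special case of a kernel of Dirac measures. -/
structure ParamDist (U : Type u) [MeasurableSpace U] where
  arity : ℕ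
  params : Set (Fin arity → U)
  measurableSet_params : MeasurableSet params
  kernel : Kernel params U
  [isMarkov : IsMarkovKernel kernel]
  range : Set U
  measurableSet_range : MeasurableSet range
  kernel_compl_range : ∀ θ, kernel θ rangeᶜ = 0

/-- Terms over a family `Ψ` of parametrised distributions, with variables from `V`. -/
inductive Term {U : Type u} [MeasurableSpace U] {J : Type w} (Ψ : J → ParamDist U) (V : Type) :
    Type (max u w)
  | var (x : V) : Term Ψ V
  | const (c : U) : Term Ψ V
  | app (j : J) (args : Fin (Ψ j).arity → Term Ψ V) : Term Ψ V

namespace Term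

variable {U : Type u} [MeasurableSpace U] {J : Type w} {Ψ : J → ParamDist U} {V : Type}

/-- The variable `x` occurs in the term. -/
def Occurs (x : V) : Term Ψ V → Prop
  | var y => y = x
  | const _ => False
  | app _ args => ∃ i, (args i).Occurs x

/-- The range of a term whose variables `x` range over `vd x`. -/
def range (vd : V → Set U) : Term Ψ V → Set U
  | var x => vd x
  | const c => {c}
  | app j _ => (Ψ j).range

/-- Each distribution symbol is applied to arguments whose ranges fit its parameter set. -/
def WellTyped (vd : V → Set U) : Term Ψ V → Prop
  | var _ => True
  | const _ => True
  | app j args => (∀ i, (args i).WellTyped vd) ∧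
      Set.univ.pi (fun i => (args i).range vd) ⊆ (Ψ j).params

/-- The distribution of a term under an assignment `α` of its variables: the arguments
of a distribution symbol are sampled independently and then used as its parameters.
(For well-typed terms, `comap` only views the law of the argument tuple, which is concentrated on
the parameter set, as a law on that set.) -/
def eval (α : V → U) : Term Ψ V → Measure U
  | var x => Measure.dirac (α x)
  | const c => Measure.dirac c
  | app j args =>
      ((Measure.pi fun i => (args i).eval α).comap
        (Subtype.val : (Ψ j).params → (Fin (Ψ j).arity → U))).bind (Ψ j).kernel

end Term

/-! ### Rules and programs -/

/-- An atom `S(x₁, …, x_k)` with variables from `V`. -/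
structure Atom {U : Type u} [MeasurableSpace U] (τ : Schema U) (V : Type) where
  rel : τ.Rel
  args : Fin (τ.arity rel) → V

/-- The atom holds in a set `F` of facts under the assignment `α`. -/
def Atom.Holds {U : Type u} [MeasurableSpace U] {τ : Schema U} {V : Type} (a : Atom τ V)
    (F : Finset (Fact τ)) (α : V → U) : Prop :=
  ∃ v : (i : Fin (τ.arity a.rel)) → τ.dom a.rel i,
    (⟨a.rel, v⟩ : Fact τ) ∈ F ∧ ∀ i, (v i : U) = α (a.args i)

/-- The values that `x` can take according to the attributes at which it occurs in the atom. -/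
def Atom.varDom {U : Type u} [MeasurableSpace U] {τ : Schema U} {V : Type} (a : Atom τ V)
    (x : V) : Set U :=
  {c | ∀ i, a.args i = x → c ∈ τ.dom a.rel i}

/-- A rule `R(t₁, …, t_k) ← S₁(x̄₁), …, S_m(x̄_m)` with extensional schema `E` and intensional schema
`I`. Its variables are indexed by `Fin numVars`, and all of them appear in the body. The body is
the list of its extensional atoms together with the list of its intensional atoms. -/
structure Rule {U : Type u} [MeasurableSpace U] (E I : Schema U) {J : Type w}
    (Ψ : J → ParamDist U) where
  numVars : ℕ
  extBody : List (Atom E (Fin numVars))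
  intBody : List (Atom I (Fin numVars))
  headRel : I.Rel
  head : Fin (I.arity headRel) → Term Ψ (Fin numVars)
  appears : ∀ x, (∃ a ∈ extBody, ∃ i, a.args i = x) ∨ (∃ a ∈ intBody, ∃ i, a.args i = x)
  wellTyped : ∀ i, (head i).WellTyped
    fun x => {c | (∀ a ∈ extBody, c ∈ a.varDom x) ∧ (∀ a ∈ intBody, c ∈ a.varDom x)}
  range_subset : ∀ i, (head i).range
    (fun x => {c | (∀ a ∈ extBody, c ∈ a.varDom x) ∧ (∀ a ∈ intBody, c ∈ a.varDom x)})
      ⊆ I.dom headRel i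

/-- A program: a finite bag of rules, given by enumerating the occurrences of its rules. -/
structure Program {U : Type u} [MeasurableSpace U] (E I : Schema U) {J : Type w}
    (Ψ : J → ParamDist U) where
  size : ℕ
  rule : Fin size → Rule E I Ψ

section Semantics

variable {U : Type u} [MeasurableSpace U] {E I : Schema U} {J : Type w} {Ψ : J → ParamDist U}

/-- An occurrence of a rule together with an assignment to its variables. -/
abbrev Firing (G : Program E I Ψ) : Type u :=
  Σ r : Fin G.size, (Fin (G.rule r).numVars → U)

/-- The rule occurrence with the instantiation of the variables that appear in its head. -/
def Firing.headInst {G : Program E I Ψ} (f : Firing G) :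
    Σ r : Fin G.size, ({x : Fin (G.rule r).numVars // ∃ i, ((G.rule r).head i).Occurs x} → U) :=
  ⟨f.1, fun x => f.2 x⟩

/-- The distribution of the fact generated by a rule application: the components of the tuple are
sampled independently from the distributions of the head terms. (`comap` views these
distributions, which are concentrated on the attribute domains, as distributions on them.) -/
def Firing.law {G : Program E I Ψ} (f : Firing G) : Measure (Fact I) :=
  (Measure.pi fun i =>
    (((G.rule f.1).head i).eval f.2).comap
      (Subtype.val : I.dom (G.rule f.1).headRel i → U)).map
    fun v => (⟨(G.rule f.1).headRel, v⟩ : Fact I)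

/-- The possible records of a finite computation: the sequence of rule applications made so far,
each with the fact that it generated. -/
abbrev History (G : Program E I Ψ) : Type u :=
  Σ n : ℕ, (Fin n → Firing G × Fact I)

namespace History

variable {G : Program E I Ψ}

/-- The history before the first rule application. -/
def empty (G : Program E I Ψ) : History G := ⟨0, Fin.elim0⟩

/-- Append the rule application `f`, which generated the fact `a`. -/
def extend (h : History G) (f : Firing G) (a : Fact I) : History G :=
  ⟨h.1 + 1, Fin.snoc (α := fun _ => Firing G × Fact I) h.2 (f, a)⟩

/-- The intensional facts generated so far. -/
def facts (h : History G) : Finset (Fact I) :=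
  open Classical in Finset.univ.image fun i => (h.2 i).2

/-- The set of generated facts as a bag instance. -/
def output (h : History G) : BagInstance I := h.facts.val

/-- On input `D`, after `h`, the body holds and the rule occurrence was not yet applied with this
instantiation of the variables in its head. -/
def Applicable (D : Finset (Fact E)) (h : History G) (f : Firing G) : Prop :=
  (∀ a ∈ (G.rule f.1).extBody, a.Holds D f.2) ∧
  (∀ a ∈ (G.rule f.1).intBody, a.Holds h.facts f.2) ∧
  ∀ i, (h.2 i).1.headInst ≠ f.headInst

/-- No rule can be applied any more. -/
def Terminal (D : Finset (Fact E)) (h : History G) : Prop :=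
  ¬ ∃ f, h.Applicable D f

end History

/-- A policy chooses, after each history that is not terminal, a rule application to make next. The
choice may depend on everything that happened so far. -/
structure Policy (G : Program E I Ψ) (D : Finset (Fact E)) where
  select : {h : History G // ¬ h.Terminal D} → Firing G
  applicable : ∀ h, History.Applicable D h.1 (select h)

variable {G : Program E I Ψ} {D : Finset (Fact E)}

/-- The distribution of the history after one more step from `h`; terminal histories are
absorbing. -/
def Policy.step (π : Policy G D) (h : History G) : Measure (History G) :=
  open Classical in
  if hh : h.Terminal D then Measure.dirac h
  else (π.select ⟨h, hh⟩).law.map fun a => h.extend (π.select ⟨h, hh⟩) a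

/-- `μ` is the law of the random infinite run under the policy `π`: it starts with the empty
history, and given the run up to time `n`, the distribution at time `n + 1` is given by
`π.step`. -/
structure Policy.IsRunLaw (π : Policy G D) (μ : Measure (ℕ → History G)) : Prop where
  isProbabilityMeasure : IsProbabilityMeasure μ
  start : ∀ᵐ ω ∂μ, ω 0 = History.empty G
  next : ∀ (n : ℕ) (A : Set (Finset.Iic n → History G)) (B : Set (History G)),
    MeasurableSet A → MeasurableSet B →
    μ {ω | (fun i : Finset.Iic n => ω i) ∈ A ∧ ω (n + 1) ∈ B} =
      ∫⁻ ω in {ω | (fun i : Finset.Iic n => ω i) ∈ A}, π.step (ω n) B ∂μ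

/-- The event that the run terminates with an output in `C`. -/
def terminatesIn (G : Program E I Ψ) (D : Finset (Fact E)) (C : Set (BagInstance I)) :
    Set (ℕ → History G) :=
  {ω | ∃ n, (ω n).Terminal D ∧ (ω n).output ∈ C}

end Semantics

end GDatalog

end

/-! Order independence comes from commuting rule applications. Bodies are monotone in the generated
facts, so an applicable firing stays applicable until its own head instance is fired, and the law of
the new fact depends on that head instance only (`Firing.law_congr`). Two applicable firings with
different head instances can therefore be made in either order: Fubini exchanges the two samples,
and the resulting histories are `Similar`, that is, they have the same facts and the same fired head
instances, which decide all that can follow. By induction, the probability of having terminated in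
`C` after `n` steps can be computed with any applicable firing as the first one
(`terminationProb_similar_and_first`). Hence it agrees for all measurable policies, for each `n` and
not only in the limit (`terminationProb_eq`).

The measure-theoretic obstacle is termination, which quantifies over uncountably many assignments.
Since every variable occurs in the body, its value can be read off a position in the input or the
history, so countably many measurable functions exhaust the applicable firings
(`exists_measurable_enumeration`). This makes termination measurable and yields a measurable policy.

The run law exists by the Ionescu-Tulcea theorem and is determined by its finite-dimensional
marginals. Terminal histories are absorbing, so the probability of terminating in `C` is the
supremum over `n` of the probabilities above. One measurable policy defines `P`; all others give the
same values. -/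

open MeasureTheory ProbabilityTheory

noncomputable section

namespace GDatalog

universe u w

/-! ### Disjoint unions of measurable spaces -/

section Sigma

variable {ι : Type*} {X : ι → Type*} [∀ i, MeasurableSpace (X i)] {Y Z : Type*}
  [MeasurableSpace Y] [MeasurableSpace Z]

theorem measurableSet_sigma_iff {s : Set (Σ i, X i)} :
    MeasurableSet s ↔ ∀ i, MeasurableSet (Sigma.mk i ⁻¹' s) := by
  simp only [MeasurableSpace.measurableSet_iInf]
  rfl

theorem measurable_sigmaMk (i : ι) : Measurable (Sigma.mk i : X i → Σ i, X i) :=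
  fun _ hs => measurableSet_sigma_iff.1 hs i

theorem measurable_sigma_iff {f : (Σ i, X i) → Z} :
    Measurable f ↔ ∀ i, Measurable fun x : X i => f ⟨i, x⟩ :=
  ⟨fun hf i => hf.comp (measurable_sigmaMk i),
    fun hf _ hs => measurableSet_sigma_iff.2 fun i => hf i hs⟩

theorem measurableEmbedding_sigmaMk (i : ι) :
    MeasurableEmbedding (Sigma.mk i : X i → Σ i, X i) where
  injective := sigma_mk_injective
  measurable := measurable_sigmaMk i
  measurableSet_image' := by
    intro s hs
    refine measurableSet_sigma_iff.2 fun j => ?_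
    by_cases h : i = j
    · subst h
      rwa [Set.preimage_image_eq _ sigma_mk_injective]
    · convert MeasurableSet.empty
      ext x
      simp only [Set.mem_preimage, Set.mem_image, Set.mem_empty_iff_false, iff_false]
      rintro ⟨y, -, hy⟩
      exact h (congrArg Sigma.fst hy)

/-- A function on the product of a countable disjoint union with another space is measurable if
it is so on each of the pieces. -/
theorem measurable_from_sigma_prod [Countable ι] {f : (Σ i, X i) × Y → Z}
    (hf : ∀ i, Measurable fun p : X i × Y => f (⟨i, p.1⟩, p.2)) : Measurable f := by
  intro s hs
  have : f ⁻¹' s = ⋃ i, Prod.map (Sigma.mk i) id ''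
      ((fun p : X i × Y => f (⟨i, p.1⟩, p.2)) ⁻¹' s) := by
    ext ⟨⟨i, x⟩, y⟩
    simp only [Set.mem_preimage, Set.mem_iUnion, Set.mem_image, Prod.exists, Prod.map_apply]
    constructor
    · exact fun h => ⟨i, x, y, h, rfl⟩
    · rintro ⟨j, x', y', h, he⟩
      simp only [id, Prod.mk.injEq] at he
      rw [← he.1, ← he.2]
      exact h
  rw [this]
  exact MeasurableSet.iUnion fun i =>
    ((measurableEmbedding_sigmaMk i).prodMap .id).measurableSet_image' (hf i hs)

theorem measurableSet_sigma_prod [Countable ι] {s : Set ((Σ i, X i) × Y)}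
    (hs : ∀ i, MeasurableSet {p : X i × Y | ((⟨i, p.1⟩ : Σ i, X i), p.2) ∈ s}) :
    MeasurableSet s := by
  have := measurable_from_sigma_prod (f := fun p => p ∈ s) fun i => measurable_mem.2 (hs i)
  exact measurable_mem.1 this

/-- Polish topologies on the pieces give one on the union, whose Borel sets must be compared with
the given σ-algebra. The point is to make equality of facts and of head instances a measurable
condition. -/
instance standardBorelSpace_sigma [Countable ι] [∀ i, StandardBorelSpace (X i)] :
    StandardBorelSpace (Σ i, X i) := by
  let := fun i => upgradeStandardBorel (X i)
  refine ⟨⟨inferInstance, ⟨?_⟩, inferInstance⟩⟩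
  refine le_antisymm ?_ ?_
  · intro s hs
    have hs' := measurableSet_sigma_iff.1 hs
    let : MeasurableSpace (Σ i, X i) := borel _
    have : BorelSpace (Σ i, X i) := ⟨rfl⟩
    have : s = ⋃ i, Sigma.mk i '' (Sigma.mk i ⁻¹' s) := by
      ext ⟨i, x⟩
      simp only [Set.mem_iUnion, Set.mem_image, Set.mem_preimage]
      exact ⟨fun h => ⟨i, x, h, rfl⟩, by rintro ⟨j, y, hy, he⟩; rwa [← he]⟩
    rw [this]
    exact MeasurableSet.iUnion fun i =>
      Topology.IsOpenEmbedding.sigmaMk.measurableEmbedding.measurableSet_image' (hs' i)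
  · refine MeasurableSpace.generateFrom_le fun s hs => measurableSet_sigma_iff.2 fun i => ?_
    exact (hs.preimage continuous_sigmaMk).measurableSet

end Sigma

/-! ### Measurable operations on measures -/

section Measure

variable {X Y : Type*} [MeasurableSpace X] [MeasurableSpace Y]

/-- The product of finitely many probability measures depends measurably on the factors. -/
theorem measurable_measure_pi {ι : Type*} [Fintype ι] {Z : ι → Type*} [∀ i, MeasurableSpace (Z i)]
    {μ : X → (i : ι) → Measure (Z i)} [∀ x i, IsProbabilityMeasure (μ x i)]
    (hμ : ∀ i, Measurable fun x => μ x i) : Measurable fun x => Measure.pi (μ x) := by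
  refine Measurable.measure_of_isPiSystem_of_isProbabilityMeasure generateFrom_pi.symm
    isPiSystem_pi ?_
  rintro _ ⟨s, hs, rfl⟩
  simp only [Measure.pi_pi]
  exact Finset.measurable_prod _ fun i _ =>
    (Measure.measurable_coe (hs i (Set.mem_univ i))).comp (hμ i)

theorem measurable_measure_comap {f : Y → X} (hf : MeasurableEmbedding f) :
    Measurable fun μ : Measure X => μ.comap f := by
  refine Measure.measurable_of_measurable_coe _ fun s hs => ?_
  simp only [hf.comap_apply]
  exact Measure.measurable_coe (hf.measurableSet_image' hs)

theorem isProbabilityMeasure_comap_val {s : Set X} (hs : MeasurableSet s) {μ : Measure X}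
    [IsProbabilityMeasure μ] (h : μ sᶜ = 0) :
    IsProbabilityMeasure (μ.comap (Subtype.val : s → X)) := by
  refine ⟨?_⟩
  rw [(MeasurableEmbedding.subtype_coe hs).comap_apply, Set.image_univ, Subtype.range_coe]
  exact (prob_compl_eq_zero_iff hs).1 h

end Measure

/-! ### Laws of terms and of rule applications -/

section

namespace Term

variable {U : Type u} [MeasurableSpace U] {J : Type w} {Ψ : J → ParamDist U} {V : Type}

theorem measurableSet_range [MeasurableSingletonClass U] {vd : V → Set U}
    (hvd : ∀ x, MeasurableSet (vd x)) (t : Term Ψ V) : MeasurableSet (t.range vd) := by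
  cases t with
  | var x => exact hvd x
  | const c => exact MeasurableSet.singleton c
  | app j args => exact (Ψ j).measurableSet_range

/-- A well-typed term denotes a probability distribution that is concentrated on its range. -/
theorem isProbabilityMeasure_eval_and_compl_range [MeasurableSingletonClass U] {vd : V → Set U}
    (hvd : ∀ x, MeasurableSet (vd x)) {α : V → U} (hα : ∀ x, α x ∈ vd x) (t : Term Ψ V)
    (ht : t.WellTyped vd) : IsProbabilityMeasure (t.eval α) ∧ t.eval α (t.range vd)ᶜ = 0 := by
  induction t with
  | var x =>
    simp only [eval, range]
    exact ⟨inferInstance, by simp [Measure.dirac_apply' _ (hvd x).compl, hα x]⟩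
  | const c =>
    simp only [eval, range]
    exact ⟨inferInstance, by simp [Measure.dirac_apply' _ (MeasurableSet.singleton c).compl]⟩
  | app j args ih =>
    have hp := fun i => (ih i (ht.1 i)).1
    -- The argument tuple almost surely lies in the product of the ranges, hence in the parameter
    -- set, so `comap` loses no mass.
    have hnull : (Measure.pi fun i => (args i).eval α) (Ψ j).paramsᶜ = 0 := by
      refine measure_mono_null (Set.compl_subset_compl.2 ht.2) ?_
      rw [prob_compl_eq_zero_iff
        (MeasurableSet.univ_pi fun i => measurableSet_range hvd (args i)), Measure.pi_pi]
      exact Finset.prod_eq_one fun i _ =>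
        (prob_compl_eq_zero_iff (measurableSet_range hvd (args i))).1 (ih i (ht.1 i)).2
    have := isProbabilityMeasure_comap_val (Ψ j).measurableSet_params hnull
    have := (Ψ j).isMarkov
    simp only [eval, range]
    refine ⟨inferInstance, ?_⟩
    rw [Measure.bind_apply (Ψ j).measurableSet_range.compl (Ψ j).kernel.aemeasurable]
    simp [(Ψ j).kernel_compl_range]

/-- The restriction to assignments within the domains makes all argument laws probability measures,
as `measurable_measure_pi` requires. -/
theorem measurable_eval [MeasurableSingletonClass U] {vd : V → Set U}
    (hvd : ∀ x, MeasurableSet (vd x)) (t : Term Ψ V) (ht : t.WellTyped vd) :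
    Measurable fun α : {α : V → U // ∀ x, α x ∈ vd x} => t.eval α.1 := by
  induction t with
  | var x =>
    exact Measure.measurable_dirac.comp ((measurable_pi_apply x).comp measurable_subtype_coe)
  | const c => exact measurable_const
  | app j args ih =>
    have := fun (α : {α : V → U // ∀ x, α x ∈ vd x}) i =>
      (isProbabilityMeasure_eval_and_compl_range hvd α.2 (args i) (ht.1 i)).1
    exact (Measure.measurable_bind' (Ψ j).kernel.measurable).comp
      ((measurable_measure_comap (MeasurableEmbedding.subtype_coe (Ψ j).measurableSet_params)).comp
        (measurable_measure_pi fun i => ih i (ht.1 i)))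

theorem eval_congr {α β : V → U} (t : Term Ψ V) (h : ∀ x, t.Occurs x → α x = β x) :
    t.eval α = t.eval β := by
  induction t with
  | var x => simp only [eval, h x rfl]
  | const c => rfl
  | app j args ih =>
    simp only [eval]
    congr! 4 with i
    exact ih i fun x hx => h x ⟨i, hx⟩

end Term

section Semantics

variable {U : Type u} [MeasurableSpace U] {E I : Schema U} {J : Type w} {Ψ : J → ParamDist U}

/-- The values that the variable `x` can take according to the body of the rule. -/
def Rule.varDom (r : Rule E I Ψ) (x : Fin r.numVars) : Set U :=
  {c | (∀ a ∈ r.extBody, c ∈ a.varDom x) ∧ (∀ a ∈ r.intBody, c ∈ a.varDom x)}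

theorem Atom.measurableSet_varDom {τ : Schema U} {V : Type} (a : Atom τ V) (x : V) :
    MeasurableSet (a.varDom x) := by
  simp only [Atom.varDom, Set.ofPred_forall]
  exact MeasurableSet.iInter fun i => MeasurableSet.iInter fun _ => τ.measurableSet_dom _ _

theorem Rule.measurableSet_varDom (r : Rule E I Ψ) (x : Fin r.numVars) :
    MeasurableSet (r.varDom x) := by
  have h {τ : Schema U} (l : List (Atom τ (Fin r.numVars))) :
      MeasurableSet {c | ∀ a ∈ l, c ∈ a.varDom x} := by
    simp only [Set.ofPred_forall]
    exact MeasurableSet.biInter l.finite_toSet.countable fun a _ => a.measurableSet_varDom x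
  exact (h r.extBody).inter (h r.intBody)

theorem Atom.Holds.mem_varDom {τ : Schema U} {V : Type} {a : Atom τ V} {F : Finset (Fact τ)}
    {α : V → U} (h : a.Holds F α) (x : V) : α x ∈ a.varDom x := by
  obtain ⟨v, -, hv⟩ := h
  rintro i rfl
  rw [← hv i]
  exact (v i).2

variable {G : Program E I Ψ}

/-- The assignment of the firing respects the domains of the attributes in the body. -/
def Firing.WellTyped (f : Firing G) : Prop :=
  ∀ x, f.2 x ∈ (G.rule f.1).varDom x

theorem History.Applicable.wellTyped {D : Finset (Fact E)} {h : History G} {f : Firing G}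
    (hf : h.Applicable D f) : f.WellTyped :=
  fun x => ⟨fun a ha => (hf.1 a ha).mem_varDom x, fun a ha => (hf.2.1 a ha).mem_varDom x⟩

theorem Firing.measurableSet_wellTyped : MeasurableSet {f : Firing G | f.WellTyped} := by
  refine measurableSet_sigma_iff.2 fun r => ?_
  have : Sigma.mk r ⁻¹' {f : Firing G | f.WellTyped} =
      Set.univ.pi fun x => (G.rule r).varDom x := by
    ext α
    simp [Firing.WellTyped]
  rw [this]
  exact MeasurableSet.univ_pi fun x => (G.rule r).measurableSet_varDom x

theorem isProbabilityMeasure_comap_eval_head [MeasurableSingletonClass U] (r : Rule E I Ψ)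
    {α : Fin r.numVars → U} (hα : ∀ x, α x ∈ r.varDom x) (i : Fin (I.arity r.headRel)) :
    IsProbabilityMeasure
      (((r.head i).eval α).comap (Subtype.val : I.dom r.headRel i → U)) := by
  obtain ⟨h₁, h₂⟩ := Term.isProbabilityMeasure_eval_and_compl_range r.measurableSet_varDom hα
    (r.head i) (r.wellTyped i)
  exact isProbabilityMeasure_comap_val (I.measurableSet_dom _ _)
    (measure_mono_null (Set.compl_subset_compl.2 (r.range_subset i)) h₂)

theorem measurable_factMk {τ : Schema U} (R : τ.Rel) :
    Measurable fun v : (i : Fin (τ.arity R)) → τ.dom R i => (⟨R, v⟩ : Fact τ) :=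
  measurable_sigmaMk (X := fun R : τ.Rel => (i : Fin (τ.arity R)) → τ.dom R i) R

theorem Firing.WellTyped.isProbabilityMeasure_law [MeasurableSingletonClass U] {f : Firing G}
    (hf : f.WellTyped) : IsProbabilityMeasure f.law := by
  have := isProbabilityMeasure_comap_eval_head (G.rule f.1) hf
  exact Measure.isProbabilityMeasure_map (measurable_factMk _).aemeasurable

theorem Firing.measurable_law [MeasurableSingletonClass U] :
    Measurable fun f : {f : Firing G // f.WellTyped} => f.1.law := by
  classical
  -- Extension by zero to all firings allows measurability to be tested rule by rule.
  suffices h : Measurable fun f : Firing G => if f.WellTyped then f.law else 0 by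
    convert h.comp measurable_subtype_coe with f
    simp [f.2]
  refine measurable_sigma_iff.2 fun r => ?_
  have hm := (measurable_sigmaMk r) (Firing.measurableSet_wellTyped (G := G))
  refine Measurable.dite (f := fun x => Firing.law (⟨r, x.1⟩ : Firing G)) (g := fun _ => 0)
    ?_ measurable_const hm
  have := fun α : {α : Fin (G.rule r).numVars → U // ∀ x, α x ∈ (G.rule r).varDom x} =>
    isProbabilityMeasure_comap_eval_head (G.rule r) α.2
  have hpi : Measurable
      fun α : {α : Fin (G.rule r).numVars → U // ∀ x, α x ∈ (G.rule r).varDom x} =>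
        Measure.pi fun i => (((G.rule r).head i).eval α.1).comap
          (Subtype.val : I.dom (G.rule r).headRel i → U) :=
    measurable_measure_pi fun i =>
      (measurable_measure_comap (MeasurableEmbedding.subtype_coe (I.measurableSet_dom _ _))).comp
        (Term.measurable_eval (G.rule r).measurableSet_varDom _ ((G.rule r).wellTyped i))
  exact (Measure.measurable_map _ (measurable_factMk (G.rule r).headRel)).comp hpi

/-- The distributions of the facts generated by the rule applications, as a kernel, with value zero
at the firings that are not well-typed. -/
def Firing.lawKernel [MeasurableSingletonClass U] (G : Program E I Ψ) :
    Kernel (Firing G) (Fact I) where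
  toFun f := open Classical in if f.WellTyped then f.law else 0
  measurable' := by
    classical
    exact Measurable.dite (f := fun f : {f : Firing G // f.WellTyped} => f.1.law)
      (g := fun _ => 0) Firing.measurable_law measurable_const Firing.measurableSet_wellTyped

theorem Firing.WellTyped.lawKernel_apply [MeasurableSingletonClass U] {f : Firing G}
    (hf : f.WellTyped) : Firing.lawKernel G f = f.law :=
  if_pos hf

instance Firing.isFiniteKernel_lawKernel [MeasurableSingletonClass U] :
    IsFiniteKernel (Firing.lawKernel G) := by
  refine ⟨1, ENNReal.one_lt_top, fun f => ?_⟩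
  by_cases hf : f.WellTyped
  · have := hf.isProbabilityMeasure_law
    simp [hf.lawKernel_apply]
  · have : Firing.lawKernel G f = 0 := if_neg hf
    simp [this]

/-- The law reads the assignment only through the variables of the head. Hence firings that block
each other are interchangeable. -/
theorem Firing.law_congr {f g : Firing G} (h : f.headInst = g.headInst) : f.law = g.law := by
  obtain ⟨r, α⟩ := f
  obtain ⟨s, β⟩ := g
  obtain rfl : r = s := congrArg Sigma.fst h
  have h' := eq_of_heq (Sigma.mk.inj h).2
  simp only [Firing.law]
  congr! 4 with i
  exact Term.eval_congr _ fun x hx => congrFun h' ⟨x, i, hx⟩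

end Semantics

end

/-! ### Measurability of outputs and of applicability -/

section

theorem measurableSet_sigma_prod_sigma {ι κ : Type*} [Countable ι] [Countable κ] {X : ι → Type*}
    {Y : κ → Type*} [∀ i, MeasurableSpace (X i)] [∀ j, MeasurableSpace (Y j)]
    {s : Set ((Σ i, X i) × (Σ j, Y j))}
    (hs : ∀ i j, MeasurableSet {p : X i × Y j | (⟨i, p.1⟩, ⟨j, p.2⟩) ∈ s}) : MeasurableSet s := by
  refine measurableSet_sigma_prod fun i => ?_
  have : MeasurableSet {q : (Σ j, Y j) × X i | ((⟨i, q.2⟩ : Σ i, X i), q.1) ∈ s} :=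
    measurableSet_sigma_prod fun j => measurable_swap (hs i j)
  exact measurable_swap this

/-- The number of values of a finite sequence that satisfy a predicate is the number of positions
at which such a value occurs for the first time. -/
theorem card_filter_image_eq_card_first {α : Type*} [DecidableEq α] {n : ℕ} (φ : Fin n → α)
    (p : α → Prop) [DecidablePred p] :
    ((Finset.univ.image φ).filter p).card =
      (Finset.univ.filter fun k => p (φ k) ∧ ∀ j < k, φ j ≠ φ k).card := by
  have himage : (Finset.univ.image φ).filter p =
      (Finset.univ.filter fun k => p (φ k) ∧ ∀ j < k, φ j ≠ φ k).image φ := by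
    ext b
    simp only [Finset.mem_filter, Finset.mem_image, Finset.mem_univ, true_and]
    constructor
    · rintro ⟨⟨k, rfl⟩, hk⟩
      obtain ⟨m, hm, hmin⟩ := wellFounded_lt.has_min {j | φ j = φ k} ⟨k, rfl⟩
      have hm : φ m = φ k := hm
      exact ⟨m, ⟨hm ▸ hk, fun j hj he => hmin j (he.trans hm) hj⟩, hm⟩
    · rintro ⟨k, ⟨hk, -⟩, rfl⟩
      exact ⟨⟨k, rfl⟩, hk⟩
  rw [himage]
  refine Finset.card_image_of_injOn fun i hi j hj hij => ?_
  simp only [Finset.coe_filter, Finset.mem_univ, true_and, Set.mem_ofPred_eq] at hi hj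
  rcases lt_trichotomy i j with h | h | h
  · exact absurd hij (hj.2 i h)
  · exact h
  · exact absurd hij.symm (hi.2 j h)

variable {U : Type u} [MeasurableSpace U]

instance (τ : Schema U) : Finite τ.Rel := τ.finite

instance [StandardBorelSpace U] (τ : Schema U) (R : τ.Rel) (i : Fin (τ.arity R)) :
    StandardBorelSpace (τ.dom R i) :=
  (τ.measurableSet_dom R i).standardBorel

namespace BagInstance

variable {τ : Schema U}

theorem measurable_count {F : Set (Fact τ)} (hF : MeasurableSet F) :
    Measurable fun B : BagInstance τ => B.count F :=
  measurable_to_countable' fun n => MeasurableSpace.measurableSet_generateFrom ⟨F, n, hF, rfl⟩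

theorem count_eq_countP (B : Multiset (Fact τ)) (F : Set (Fact τ)) [DecidablePred (· ∈ F)] :
    BagInstance.count (τ := τ) B F = B.countP (· ∈ F) := by
  unfold BagInstance.count
  congr!

theorem count_val (s : Finset (Fact τ)) (F : Set (Fact τ)) [DecidablePred (· ∈ F)] :
    BagInstance.count (τ := τ) s.val F = (s.filter (· ∈ F)).card :=
  (count_eq_countP s.val F).trans (Multiset.countP_eq_card_filter _ s.val)

/-- The first `n` bits of `φ` cut the facts into finitely many cells. Finitely many distinct facts
are separated by finitely many bits, whereas a repeated fact overfills its cell for every `n`.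
Absence of duplicates thus becomes a countable condition on counts. -/
theorem isSet_iff_exists_count_le_one {φ : Fact τ → ℕ → Bool} (hφ : Function.Injective φ)
    (B : BagInstance τ) :
    B.IsSet ↔ ∃ n : ℕ, ∀ p : Fin n → Bool, B.count {b | ∀ i : Fin n, φ b i = p i} ≤ 1 := by
  classical
  constructor
  · intro hB
    have hne : ∀ q : Fact τ × Fact τ, ∃ m, q.1 ≠ q.2 → φ q.1 m ≠ φ q.2 m := by
      intro q
      by_cases hq : q.1 = q.2
      · exact ⟨0, fun h => absurd hq h⟩
      · obtain ⟨m, hm⟩ := Function.ne_iff.1 fun h => hq (hφ h)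
        exact ⟨m, fun _ => hm⟩
    choose m hm using hne
    let s : Finset (Fact τ) := ⟨B, hB⟩
    refine ⟨(s ×ˢ s).sup m + 1, fun p => ?_⟩
    refine (count_val s _).trans_le ?_
    refine Finset.card_le_one.2 fun a ha b hb => ?_
    rw [Finset.mem_filter] at ha hb
    by_contra hab
    have hlt : m (a, b) < (s ×ˢ s).sup m + 1 :=
      Nat.lt_succ_of_le (Finset.le_sup (f := m) (Finset.mk_mem_product ha.1 hb.1))
    exact hm (a, b) hab ((ha.2 ⟨_, hlt⟩).trans (hb.2 ⟨_, hlt⟩).symm)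
  · rintro ⟨n, hn⟩
    refine Multiset.nodup_iff_count_le_one.2 fun a => ?_
    refine le_trans ?_ (hn fun i => φ a i)
    refine (Multiset.countP_eq_card_filter _ B).trans_le (le_of_le_of_eq ?_
      ((count_eq_countP B _).trans (Multiset.countP_eq_card_filter _ B)).symm)
    refine Multiset.card_le_card (Multiset.monotone_filter_right _ fun b hb => ?_)
    subst hb
    exact fun i => rfl

theorem measurableSet_isSet [StandardBorelSpace U] :
    MeasurableSet {B : BagInstance τ | B.IsSet} := by
  obtain ⟨φ, hφ, hinj⟩ :=
    MeasurableSpace.measurable_injection_nat_bool_of_countablySeparated (Fact τ)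
  simp only [isSet_iff_exists_count_le_one hinj]
  rw [Set.ofPred_exists]
  refine MeasurableSet.iUnion fun n => ?_
  rw [Set.ofPred_forall]
  refine MeasurableSet.iInter fun p => ?_
  have hF : MeasurableSet {b : Fact τ | ∀ i : Fin n, φ b i = p i} := by
    simp only [Set.ofPred_forall]
    exact MeasurableSet.iInter fun i =>
      ((measurable_pi_apply (i : ℕ)).comp hφ) (measurableSet_singleton (p i))
  exact measurable_count hF measurableSet_Iic

end BagInstance

/-- The atom, instantiated by the assignment `α`, is the fact `b`. -/
def Atom.Matches {τ : Schema U} {V : Type} (a : Atom τ V) (b : Fact τ) (α : V → U) : Prop :=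
  ∃ v : (i : Fin (τ.arity a.rel)) → τ.dom a.rel i,
    (⟨a.rel, v⟩ : Fact τ) = b ∧ ∀ i, (v i : U) = α (a.args i)

theorem Atom.holds_iff {τ : Schema U} {V : Type} {a : Atom τ V} {F : Finset (Fact τ)}
    {α : V → U} : a.Holds F α ↔ ∃ b ∈ F, a.Matches b α :=
  ⟨fun ⟨v, hv, h⟩ => ⟨_, hv, v, rfl, h⟩, fun ⟨_, hb, v, hv, h⟩ => ⟨v, hv ▸ hb, h⟩⟩

theorem Atom.measurableSet_matches [StandardBorelSpace U] {τ : Schema U} {V : Type}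
    (a : Atom τ V) : MeasurableSet {p : Fact τ × (V → U) | a.Matches p.1 p.2} := by
  refine measurableSet_sigma_prod fun R => ?_
  by_cases hR : a.rel = R
  · subst hR
    have : {p : ((i : Fin (τ.arity a.rel)) → τ.dom a.rel i) × (V → U) |
        ((⟨a.rel, p.1⟩ : Fact τ), p.2) ∈ {p : Fact τ × (V → U) | a.Matches p.1 p.2}} =
        {p | ∀ i, (p.1 i : U) = p.2 (a.args i)} := by
      ext p
      simp only [Set.mem_ofPred_eq, Atom.Matches]
      constructor
      · rintro ⟨v, hv, h⟩
        rwa [← eq_of_heq (Sigma.mk.inj hv).2]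
      · exact fun h => ⟨p.1, rfl, h⟩
    rw [this]
    simp only [Set.ofPred_forall]
    refine MeasurableSet.iInter fun i => measurableSet_eq_fun ?_ ?_
    · exact measurable_subtype_coe.comp ((measurable_pi_apply i).comp measurable_fst)
    · exact (measurable_pi_apply (a.args i)).comp measurable_snd
  · convert MeasurableSet.empty
    ext p
    simp only [Set.mem_ofPred_eq, Atom.Matches, Set.mem_empty_iff_false, iff_false]
    rintro ⟨v, hv, -⟩
    exact hR (congrArg Sigma.fst hv)

variable {E I : Schema U} {J : Type w} {Ψ : J → ParamDist U} {G : Program E I Ψ}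

theorem Firing.measurable_headInst : Measurable (Firing.headInst (G := G)) := by
  refine measurable_sigma_iff.2 fun r => (measurable_sigmaMk (X := fun r : Fin G.size =>
    ({x : Fin (G.rule r).numVars // ∃ i, ((G.rule r).head i).Occurs x} → U)) r).comp ?_
  exact measurable_pi_lambda _ fun x => measurable_pi_apply x.1

namespace History

theorem mem_facts {h : History G} {b : Fact I} : b ∈ h.facts ↔ ∃ k, (h.2 k).2 = b := by
  simp [facts]

theorem measurable_extend :
    Measurable fun p : History G × (Firing G × Fact I) => p.1.extend p.2.1 p.2.2 := by
  refine measurable_from_sigma_prod fun n =>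
    (measurable_sigmaMk (X := fun n : ℕ => Fin n → Firing G × Fact I) (n + 1)).comp ?_
  refine measurable_pi_lambda _ fun k => ?_
  induction k using Fin.lastCases with
  | last => simpa using measurable_snd
  | cast k => simpa [Function.comp_def] using (measurable_pi_apply k).comp measurable_fst

/-- A fact generated repeatedly counts once. Counting it at its first position only turns the count
into a finite sum of indicators of measurable events. -/
theorem measurable_output [StandardBorelSpace U] : Measurable (output (G := G)) := by
  classical
  refine measurable_generateFrom ?_
  rintro _ ⟨F, m, hF, rfl⟩
  refine measurableSet_sigma_iff.2 fun n => ?_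
  have hcount : ∀ w : Fin n → Firing G × Fact I, (output ⟨n, w⟩).count F =
      ∑ k, if (w k).2 ∈ F ∧ ∀ j < k, (w j).2 ≠ (w k).2 then 1 else 0 := by
    intro w
    have hfacts : Finset.univ.image (fun k => (w k).2) = facts ⟨n, w⟩ := by
      ext; simp [mem_facts]
    rw [← Finset.card_filter, ← card_filter_image_eq_card_first (fun k => (w k).2) (· ∈ F), hfacts]
    exact BagInstance.count_val _ F
  have hmeas : Measurable fun w : Fin n → Firing G × Fact I => (output ⟨n, w⟩).count F := by
    simp only [hcount]
    have hcoord : ∀ k : Fin n, Measurable fun w : Fin n → Firing G × Fact I => (w k).2 :=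
      fun k => measurable_snd.comp (measurable_pi_apply k)
    refine Finset.measurable_sum _ fun k _ => Measurable.ite ?_ measurable_const measurable_const
    have hfirst : MeasurableSet
        {w : Fin n → Firing G × Fact I | ∀ j < k, (w j).2 ≠ (w k).2} := by
      simp only [Set.ofPred_forall]
      exact MeasurableSet.iInter fun j => MeasurableSet.iInter fun _ =>
        (measurableSet_eq_fun (hcoord j) (hcoord k)).compl
    exact (hcoord k hF).inter hfirst
  exact hmeas (measurableSet_singleton m)

theorem measurableSet_applicable [StandardBorelSpace U] (D : Finset (Fact E)) :
    MeasurableSet {p : History G × Firing G | p.1.Applicable D p.2} := by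
  refine measurableSet_sigma_prod_sigma fun n r => ?_
  have hfact : ∀ k : Fin n, Measurable fun p : (Fin n → Firing G × Fact I) ×
      (Fin (G.rule r).numVars → U) => (p.1 k).2 :=
    fun k => measurable_snd.comp ((measurable_pi_apply k).comp measurable_fst)
  have hfiring : ∀ k : Fin n, Measurable fun p : (Fin n → Firing G × Fact I) ×
      (Fin (G.rule r).numVars → U) => (p.1 k).1 :=
    fun k => measurable_fst.comp ((measurable_pi_apply k).comp measurable_fst)
  refine MeasurableSet.inter ?_ (MeasurableSet.inter ?_ ?_)
  · show MeasurableSet {p : (Fin n → Firing G × Fact I) × (Fin (G.rule r).numVars → U) |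
      ∀ a ∈ (G.rule r).extBody, a.Holds D p.2}
    simp only [Atom.holds_iff, Set.ofPred_forall]
    refine MeasurableSet.biInter (G.rule r).extBody.finite_toSet.countable fun a _ => ?_
    have : {p : (Fin n → Firing G × Fact I) × (Fin (G.rule r).numVars → U) |
        ∃ b ∈ D, a.Matches b p.2} = ⋃ b ∈ D, {p | a.Matches b p.2} := by
      ext p; simp
    rw [this]
    exact D.measurableSet_biUnion fun b _ =>
      (measurable_const.prodMk measurable_snd) a.measurableSet_matches
  · show MeasurableSet {p : (Fin n → Firing G × Fact I) × (Fin (G.rule r).numVars → U) |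
      ∀ a ∈ (G.rule r).intBody, a.Holds (facts ⟨n, p.1⟩) p.2}
    simp only [Atom.holds_iff, Set.ofPred_forall]
    refine MeasurableSet.biInter (G.rule r).intBody.finite_toSet.countable fun a _ => ?_
    have : {p : (Fin n → Firing G × Fact I) × (Fin (G.rule r).numVars → U) |
        ∃ b ∈ facts ⟨n, p.1⟩, a.Matches b p.2} = ⋃ k, {p | a.Matches (p.1 k).2 p.2} := by
      ext p; simp [mem_facts]
    rw [this]
    exact MeasurableSet.iUnion fun k =>
      ((hfact k).prodMk measurable_snd) a.measurableSet_matches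
  · show MeasurableSet {p : (Fin n → Firing G × Fact I) × (Fin (G.rule r).numVars → U) |
      ∀ k, (p.1 k).1.headInst ≠ Firing.headInst ⟨r, p.2⟩}
    simp only [Set.ofPred_forall]
    refine MeasurableSet.iInter fun k => (measurableSet_eq_fun
      (Firing.measurable_headInst.comp (hfiring k)) (Firing.measurable_headInst.comp ?_)).compl
    exact (measurable_sigmaMk (X := fun r : Fin G.size => Fin (G.rule r).numVars → U) r).comp
      measurable_snd

end History

/-- The `j`-th attribute of a fact, or `d` if there is none. -/
def Fact.attr {τ : Schema U} (j : ℕ) (d : U) (b : Fact τ) : U :=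
  if h : j < τ.arity b.1 then b.2 ⟨j, h⟩ else d

theorem Fact.measurable_attr {τ : Schema U} (j : ℕ) (d : U) :
    Measurable (Fact.attr (τ := τ) j d) := by
  refine measurable_sigma_iff.2 fun R => ?_
  by_cases h : j < τ.arity R
  · simp only [Fact.attr, h, dite_true]
    exact measurable_subtype_coe.comp
      (measurable_pi_apply (X := fun i => τ.dom R i) (⟨j, h⟩ : Fin (τ.arity R)))
  · simp only [Fact.attr, h, dite_false]
    exact measurable_const

/-! ### Enumeration of applicable firings and measurable policies -/

namespace History

/-- The value at a position in the input or in the history, or `d` if there is no such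
position. -/
def value {D : Finset (Fact E)} (h : History G) (p : (D × ℕ) ⊕ (ℕ × ℕ)) (d : U) : U :=
  match p with
  | .inl q => q.1.1.attr q.2 d
  | .inr q => if hk : q.1 < h.1 then (h.2 ⟨q.1, hk⟩).2.attr q.2 d else d

theorem measurable_value {D : Finset (Fact E)} (p : (D × ℕ) ⊕ (ℕ × ℕ)) (d : U) :
    Measurable fun h : History G => h.value p d := by
  rcases p with q | q
  · exact measurable_const
  · refine measurable_sigma_iff.2 fun n => ?_
    by_cases h : q.1 < n
    · simp only [value, h, dite_true]
      exact (Fact.measurable_attr _ _).comp (measurable_snd.comp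
        (measurable_pi_apply (X := fun _ => Firing G × Fact I) (⟨q.1, h⟩ : Fin n)))
    · simp only [value, h, dite_false]
      exact measurable_const

/-- Each variable occurs in a body atom, and the fact matching that atom sits in the input or at a
position of the history. This position exists, so the default `d` is irrelevant. -/
theorem Applicable.exists_value_eq {D : Finset (Fact E)} {h : History G} {f : Firing G}
    (hf : h.Applicable D f) (x : Fin (G.rule f.1).numVars) :
    ∃ p : (D × ℕ) ⊕ (ℕ × ℕ), ∀ d, h.value p d = f.2 x := by
  rcases (G.rule f.1).appears x with ⟨a, ha, i, rfl⟩ | ⟨a, ha, i, rfl⟩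
  · obtain ⟨v, hv, he⟩ := hf.1 a ha
    exact ⟨.inl (⟨_, hv⟩, i), fun d => by simp [value, Fact.attr, he]⟩
  · obtain ⟨v, hv, he⟩ := hf.2.1 a ha
    obtain ⟨k, hk⟩ := mem_facts.1 hv
    refine ⟨.inr (k, i), fun d => ?_⟩
    simp only [value, k.2, dite_true, Fin.eta]
    rw [hk]
    simp [Fact.attr, he]

/-- The applicable firings are among the values of countably many measurable functions. -/
theorem exists_measurable_enumeration (D : Finset (Fact E)) (f₀ : Firing G) :
    ∃ F : ℕ → History G → Firing G, (∀ n, Measurable (F n)) ∧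
      ∀ h f, h.Applicable D f → ∃ n, F n h = f := by
  classical
  -- A code is a rule together with a position from which to read each of its variables; there are
  -- countably many.
  let ι := Σ r : Fin G.size, (Fin (G.rule r).numVars → (D × ℕ) ⊕ (ℕ × ℕ))
  have : Nonempty ι := ⟨⟨f₀.1, fun _ => .inr (0, 0)⟩⟩
  obtain ⟨e, he⟩ := exists_surjective_nat ι
  let F (c : ι) (h : History G) : Firing G :=
    -- Default values come from some assignment of the rule itself: `U` may be empty while a rule
    -- without variables still has its one assignment.
    if hne : Nonempty (Fin (G.rule c.1).numVars → U)
    then ⟨c.1, fun x => h.value (c.2 x) (hne.some x)⟩ else f₀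
  refine ⟨fun n => F (e n), fun n => ?_, fun h f hf => ?_⟩
  · by_cases hne : Nonempty (Fin (G.rule (e n).1).numVars → U)
    · simp only [F, hne, dite_true]
      exact (measurable_sigmaMk (X := fun r : Fin G.size => Fin (G.rule r).numVars → U) _).comp
        (measurable_pi_lambda _ fun x => measurable_value _ _)
    · simp only [F, hne, dite_false]
      exact measurable_const
  · choose p hp using hf.exists_value_eq
    obtain ⟨n, hn⟩ := he ⟨f.1, p⟩
    refine ⟨n, ?_⟩
    have hne : Nonempty (Fin (G.rule f.1).numVars → U) := ⟨f.2⟩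
    simp only [hn, F, hne, dite_true, hp]

theorem measurableSet_terminal [StandardBorelSpace U] (D : Finset (Fact E)) :
    MeasurableSet {h : History G | h.Terminal D} := by
  refine MeasurableSet.compl (s := {h : History G | ∃ f, h.Applicable D f}) ?_
  rcases isEmpty_or_nonempty (Firing G) with hE | ⟨⟨f₀⟩⟩
  · simp
  · obtain ⟨F, hF, hsurj⟩ := exists_measurable_enumeration (G := G) D f₀
    have : {h : History G | ∃ f, h.Applicable D f} = ⋃ n, {h | h.Applicable D (F n h)} := by
      ext h
      simp only [Set.mem_ofPred_eq, Set.mem_iUnion]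
      constructor
      · rintro ⟨f, hf⟩
        obtain ⟨n, rfl⟩ := hsurj h f hf
        exact ⟨n, hf⟩
      · exact fun ⟨n, hn⟩ => ⟨_, hn⟩
    rw [this]
    exact MeasurableSet.iUnion fun n =>
      (measurable_id.prodMk (hF n)) (measurableSet_applicable D)

end History

/-- The policy takes the first applicable firing of the enumeration. -/
theorem Policy.exists_measurable [StandardBorelSpace U] (G : Program E I Ψ)
    (D : Finset (Fact E)) : ∃ π : Policy G D, Measurable π.select := by
  classical
  rcases isEmpty_or_nonempty {h : History G // ¬ h.Terminal D} with hE | ⟨⟨h₀⟩⟩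
  · exact ⟨⟨fun h => hE.elim h, fun h => hE.elim h⟩, measurable_of_empty _⟩
  · obtain ⟨f₀, -⟩ := not_not.1 h₀.2
    obtain ⟨F, hF, hsurj⟩ := History.exists_measurable_enumeration (G := G) D f₀
    have hex : ∀ h : {h : History G // ¬ h.Terminal D}, ∃ n, h.1.Applicable D (F n h.1) := by
      intro h
      obtain ⟨f, hf⟩ := not_not.1 h.2
      obtain ⟨n, rfl⟩ := hsurj h.1 f hf
      exact ⟨n, hf⟩
    refine ⟨⟨fun h => F (Nat.find (hex h)) h.1, fun h => Nat.find_spec (hex h)⟩, ?_⟩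
    have hfind : Measurable fun h => Nat.find (hex h) :=
      measurable_find hex fun n =>
        (measurable_subtype_coe.prodMk ((hF n).comp measurable_subtype_coe))
          (History.measurableSet_applicable D)
    have hFn : Measurable fun p : History G × ℕ => F p.2 p.1 :=
      measurable_from_prod_countable_left hF
    exact hFn.comp (measurable_subtype_coe.prodMk hfind)

end

/-! ### Commuting rule applications -/

section

variable {U : Type u} [MeasurableSpace U] {E I : Schema U} {J : Type w} {Ψ : J → ParamDist U}
  {G : Program E I Ψ} {D : Finset (Fact E)}

theorem Atom.Holds.mono {τ : Schema U} {V : Type} {a : Atom τ V} {F F' : Finset (Fact τ)}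
    {α : V → U} (h : a.Holds F α) (hF : F ⊆ F') : a.Holds F' α :=
  let ⟨v, hv, he⟩ := h
  ⟨v, hF hv, he⟩

namespace History

/-- The head instances of the rule applications made so far. -/
def fired (h : History G) :
    Set (Σ r : Fin G.size, ({x : Fin (G.rule r).numVars // ∃ i, ((G.rule r).head i).Occurs x} → U)) :=
  Set.range fun i => (h.2 i).1.headInst

theorem applicable_iff {h : History G} {f : Firing G} :
    h.Applicable D f ↔ (∀ a ∈ (G.rule f.1).extBody, a.Holds D f.2) ∧
      (∀ a ∈ (G.rule f.1).intBody, a.Holds h.facts f.2) ∧ f.headInst ∉ h.fired := by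
  simp [Applicable, fired]

theorem facts_extend [DecidableEq (Fact I)] (h : History G) (f : Firing G) (a : Fact I) :
    (h.extend f a).facts = insert a h.facts := by
  ext b
  rw [Finset.mem_insert, mem_facts, mem_facts]
  constructor
  · rintro ⟨k, rfl⟩
    revert k
    refine Fin.lastCases ?_ fun k => ?_
    · left; simp [extend]
    · right; exact ⟨k, by simp [extend]⟩
  · rintro (rfl | ⟨k, rfl⟩)
    · exact ⟨Fin.last _, by simp [extend]⟩
    · exact ⟨k.castSucc, by simp [extend]⟩

theorem fired_extend (h : History G) (f : Firing G) (a : Fact I) :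
    (h.extend f a).fired = insert f.headInst h.fired := by
  ext b
  simp only [fired, Set.mem_insert_iff, Set.mem_range]
  constructor
  · rintro ⟨k, rfl⟩
    revert k
    refine Fin.lastCases ?_ fun k => ?_
    · left; simp [extend]
    · right; exact ⟨k, by simp [extend]⟩
  · rintro (rfl | ⟨k, rfl⟩)
    · exact ⟨Fin.last _, by simp [extend]⟩
    · exact ⟨k.castSucc, by simp [extend]⟩

/-- Bodies contain no negation, so new facts cannot invalidate them; only the head instance just
fired becomes blocked. -/
theorem Applicable.extend {h : History G} {f g : Firing G} (hg : h.Applicable D g)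
    (hfg : f.headInst ≠ g.headInst) (a : Fact I) : (h.extend f a).Applicable D g := by
  classical
  rw [applicable_iff] at hg ⊢
  refine ⟨hg.1, fun b hb => (hg.2.1 b hb).mono ?_, ?_⟩
  · rw [facts_extend]
    exact Finset.subset_insert _ _
  · rw [fired_extend, Set.mem_insert_iff]
    rintro (h' | h')
    · exact hfg h'.symm
    · exact hg.2.2 h'

/-- Two histories agree in all that matters for what can happen next and for the output. -/
def Similar (h h' : History G) : Prop :=
  h.facts = h'.facts ∧ h.fired = h'.fired

theorem Similar.applicable_iff {h h' : History G} (hs : h.Similar h') {f : Firing G} :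
    h.Applicable D f ↔ h'.Applicable D f := by
  rw [History.applicable_iff, History.applicable_iff, hs.1, hs.2]

theorem Similar.terminal_iff {h h' : History G} (hs : h.Similar h') :
    h.Terminal D ↔ h'.Terminal D := by
  simp only [Terminal, hs.applicable_iff]

theorem Similar.output_eq {h h' : History G} (hs : h.Similar h') : h.output = h'.output :=
  congrArg Finset.val hs.1

theorem Similar.extend {h h' : History G} (hs : h.Similar h') {f g : Firing G}
    (hfg : f.headInst = g.headInst) (a : Fact I) : (h.extend f a).Similar (h'.extend g a) := by
  classical
  refine ⟨?_, ?_⟩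
  · rw [facts_extend, facts_extend, hs.1]
  · rw [fired_extend, fired_extend, hs.2, hfg]

theorem similar_extend_extend (h : History G) (f g : Firing G) (a b : Fact I) :
    ((h.extend f a).extend g b).Similar ((h.extend g b).extend f a) := by
  classical
  refine ⟨?_, ?_⟩
  · simp only [facts_extend]
    exact Finset.insert_comm _ _ _
  · simp only [fired_extend]
    exact Set.insert_comm _ _ _

theorem measurable_extend_right (h : History G) (f : Firing G) :
    Measurable fun a => h.extend f a :=
  measurable_extend.comp (measurable_const.prodMk (measurable_const.prodMk measurable_id))

end History

/-! ### Termination probabilities and their independence of the policy -/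

namespace Policy

theorem step_of_terminal (π : Policy G D) {h : History G} (hh : h.Terminal D) :
    π.step h = Measure.dirac h :=
  dif_pos hh

theorem step_of_not_terminal (π : Policy G D) {h : History G} (hh : ¬ h.Terminal D) :
    π.step h = (π.select ⟨h, hh⟩).law.map fun a => h.extend (π.select ⟨h, hh⟩) a :=
  dif_neg hh

theorem isProbabilityMeasure_step [MeasurableSingletonClass U] (π : Policy G D) (h : History G) :
    IsProbabilityMeasure (π.step h) := by
  by_cases hh : h.Terminal D
  · rw [π.step_of_terminal hh]
    infer_instance
  · rw [π.step_of_not_terminal hh]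
    have := (π.applicable ⟨h, hh⟩).wellTyped.isProbabilityMeasure_law
    exact Measure.isProbabilityMeasure_map (h.measurable_extend_right _).aemeasurable

/-- The probability of having terminated with an output in `C` after `n` more steps from `h`. -/
def terminationProb (π : Policy G D) (C : Set (BagInstance I)) : ℕ → History G → ENNReal
  | 0 => {h | h.Terminal D ∧ h.output ∈ C}.indicator 1
  | n + 1 => fun h => ∫⁻ h', π.terminationProb C n h' ∂π.step h

variable {C : Set (BagInstance I)}

theorem terminationProb_zero_of_applicable (π : Policy G D) {h : History G} {f : Firing G}
    (hf : h.Applicable D f) : π.terminationProb C 0 h = 0 := by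
  rw [terminationProb, Set.indicator_of_notMem]
  exact fun hh => hh.1 ⟨f, hf⟩

variable [StandardBorelSpace U]

theorem measurable_step {π : Policy G D} (hπ : Measurable π.select) : Measurable π.step := by
  classical
  suffices h : Measurable fun h : {h : History G // ¬ h.Terminal D} =>
      (π.select h).law.map fun a => h.1.extend (π.select h) a from
    Measurable.dite (s := {h : History G | h.Terminal D})
      (Measure.measurable_dirac.comp measurable_subtype_coe) h (History.measurableSet_terminal D)
  let κ : Kernel {h : History G // ¬ h.Terminal D} (Fact I) :=
    (Firing.lawKernel G).comap π.select hπ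
  refine Measure.measurable_of_measurable_coe _ fun s hs => ?_
  have hext : Measurable fun p : {h : History G // ¬ h.Terminal D} × Fact I =>
      p.1.1.extend (π.select p.1) p.2 :=
    History.measurable_extend.comp ((measurable_subtype_coe.comp measurable_fst).prodMk
      ((hπ.comp measurable_fst).prodMk measurable_snd))
  convert κ.measurable_kernel_prodMk_left (hext hs) using 2 with h
  rw [Measure.map_apply (h.1.measurable_extend_right _) hs, Kernel.comap_apply,
    (π.applicable h).wellTyped.lawKernel_apply]
  rfl

/-- The one-step transition law of a measurable policy, as a kernel. -/
def stepKernel (π : Policy G D) (hπ : Measurable π.select) : Kernel (History G) (History G) where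
  toFun := π.step
  measurable' := measurable_step hπ

instance (π : Policy G D) (hπ : Measurable π.select) : IsMarkovKernel (π.stepKernel hπ) :=
  ⟨π.isProbabilityMeasure_step⟩

theorem measurableSet_terminal_output (D : Finset (Fact E)) (hC : MeasurableSet C) :
    MeasurableSet {h : History G | h.Terminal D ∧ h.output ∈ C} :=
  (History.measurableSet_terminal D).inter (History.measurable_output hC)

theorem measurable_terminationProb {π : Policy G D} (hπ : Measurable π.select)
    (hC : MeasurableSet C) (n : ℕ) : Measurable (π.terminationProb C n) := by
  induction n with
  | zero => exact measurable_one.indicator (measurableSet_terminal_output D hC)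
  | succ n ih => exact ih.lintegral_kernel (κ := π.stepKernel hπ)

theorem terminationProb_succ_of_terminal {π : Policy G D} (hπ : Measurable π.select)
    (hC : MeasurableSet C) (n : ℕ) {h : History G} (hh : h.Terminal D) :
    π.terminationProb C (n + 1) h = π.terminationProb C n h := by
  simp only [terminationProb]
  rw [π.step_of_terminal hh, lintegral_dirac' _ (measurable_terminationProb hπ hC n)]

theorem terminationProb_succ_of_not_terminal {π : Policy G D} (hπ : Measurable π.select)
    (hC : MeasurableSet C) (n : ℕ) {h : History G} (hh : ¬ h.Terminal D) :
    π.terminationProb C (n + 1) h =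
      ∫⁻ a, π.terminationProb C n (h.extend (π.select ⟨h, hh⟩) a) ∂(π.select ⟨h, hh⟩).law := by
  simp only [terminationProb]
  rw [π.step_of_not_terminal hh,
    lintegral_map (measurable_terminationProb hπ hC n) (h.measurable_extend_right _)]

/-- It does not matter which applicable rule is applied first, provided that the termination
probabilities for fewer steps do not depend on the order of the rule applications. -/
theorem terminationProb_succ_eq_lintegral_of {π : Policy G D} (hπ : Measurable π.select)
    (hC : MeasurableSet C) {n : ℕ}
    (hsim : ∀ m ≤ n, ∀ h h' : History G, h.Similar h' →
      π.terminationProb C m h = π.terminationProb C m h')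
    (hfirst : ∀ m < n, ∀ (h : History G) (f : Firing G), h.Applicable D f →
      π.terminationProb C (m + 1) h = ∫⁻ a, π.terminationProb C m (h.extend f a) ∂f.law)
    {h : History G} {f : Firing G} (hf : h.Applicable D f) :
    π.terminationProb C (n + 1) h = ∫⁻ a, π.terminationProb C n (h.extend f a) ∂f.law := by
  have hh : ¬ h.Terminal D := fun hh => hh ⟨f, hf⟩
  rw [terminationProb_succ_of_not_terminal hπ hC n hh]
  have hg := π.applicable ⟨h, hh⟩
  generalize π.select ⟨h, hh⟩ = g at hg ⊢
  -- Firings with equal head instances have the same law and lead to similar histories.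
  by_cases hfg : f.headInst = g.headInst
  · rw [Firing.law_congr hfg]
    exact lintegral_congr fun a => hsim n le_rfl _ _
      (History.Similar.extend ⟨rfl, rfl⟩ hfg.symm a)
  · cases n with
    -- After either firing the other is still applicable, so a single step cannot terminate and both
    -- sides vanish.
    | zero =>
      simp only [fun a => π.terminationProb_zero_of_applicable (C := C) (hf.extend (Ne.symm hfg) a),
        fun a => π.terminationProb_zero_of_applicable (C := C) (hg.extend hfg a), lintegral_zero]
    | succ n =>
      have := hf.wellTyped.isProbabilityMeasure_law
      have := hg.wellTyped.isProbabilityMeasure_law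
      -- After `g` the firing `f` may come next, and after `f` the firing `g`. Both sides become
      -- double integrals, which Fubini and similarity identify.
      simp only [fun b => hfirst n n.lt_succ_self _ f (hf.extend (Ne.symm hfg) b),
        fun a => hfirst n n.lt_succ_self _ g (hg.extend hfg a)]
      rw [lintegral_lintegral_swap]
      · exact lintegral_congr fun a => lintegral_congr fun b =>
          hsim n n.le_succ _ _ (h.similar_extend_extend g f b a)
      · refine ((measurable_terminationProb hπ hC n).comp
          (History.measurable_extend.comp (Measurable.prodMk ?_
            (measurable_const.prodMk measurable_snd)))).aemeasurable
        exact (h.measurable_extend_right g).comp measurable_fst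

/-- The two claims need each other. The policy may choose differently after similar histories, so
comparing them requires forcing a common first firing; exchanging the first firing in turn produces
histories that are only similar. -/
theorem terminationProb_similar_and_first {π : Policy G D} (hπ : Measurable π.select)
    (hC : MeasurableSet C) (n : ℕ) :
    (∀ h h' : History G, h.Similar h' →
      π.terminationProb C n h = π.terminationProb C n h') ∧
    ∀ (h : History G) (f : Firing G), h.Applicable D f →
      π.terminationProb C (n + 1) h = ∫⁻ a, π.terminationProb C n (h.extend f a) ∂f.law := by
  induction n using Nat.strong_induction_on with
  | _ n ih =>
    have hsim : ∀ h h' : History G, h.Similar h' →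
        π.terminationProb C n h = π.terminationProb C n h' := by
      intro h h' hs
      cases n with
      | zero =>
        classical
        simp only [terminationProb, Set.indicator, Set.mem_ofPred_eq, Pi.one_apply]
        rw [hs.output_eq]
        exact if_congr (and_congr_left' hs.terminal_iff) rfl rfl
      | succ n =>
        have ihn := ih n n.lt_succ_self
        by_cases hh : h.Terminal D
        · rw [terminationProb_succ_of_terminal hπ hC n hh,
            terminationProb_succ_of_terminal hπ hC n (hs.terminal_iff.1 hh)]
          exact ihn.1 h h' hs
        · obtain ⟨f, hf⟩ := not_not.1 hh
          rw [ihn.2 h f hf, ihn.2 h' f (hs.applicable_iff.1 hf)]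
          exact lintegral_congr fun a => ihn.1 _ _ (hs.extend rfl a)
    refine ⟨hsim, fun h f hf => terminationProb_succ_eq_lintegral_of hπ hC (fun m hm => ?_)
      (fun m hm => (ih m hm).2) hf⟩
    rcases hm.eq_or_lt with rfl | hm
    · exact hsim
    · exact (ih m hm).1

/-- The termination probabilities do not depend on the policy. -/
theorem terminationProb_eq {π π' : Policy G D} (hπ : Measurable π.select)
    (hπ' : Measurable π'.select) (hC : MeasurableSet C) (n : ℕ) (h : History G) :
    π.terminationProb C n h = π'.terminationProb C n h := by
  induction n generalizing h with
  | zero => rfl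
  | succ n ih =>
    by_cases hh : h.Terminal D
    · rw [terminationProb_succ_of_terminal hπ hC n hh,
        terminationProb_succ_of_terminal hπ' hC n hh, ih]
    -- The value for `π'` is computed with the choice of `π` as first firing.
    · rw [terminationProb_succ_of_not_terminal hπ hC n hh,
        (terminationProb_similar_and_first hπ' hC n).2 h _ (π.applicable ⟨h, hh⟩)]
      exact lintegral_congr fun a => ih _

end Policy

end

/-! ### Existence and uniqueness of the run law -/

section

variable {U : Type u} [MeasurableSpace U] {E I : Schema U} {J : Type w} {Ψ : J → ParamDist U}
  {G : Program E I Ψ} {D : Finset (Fact E)}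

theorem measurableSet_terminatesIn [StandardBorelSpace U] (G : Program E I Ψ)
    (D : Finset (Fact E)) {C : Set (BagInstance I)} (hC : MeasurableSet C) :
    MeasurableSet (terminatesIn G D C) := by
  rw [terminatesIn, Set.ofPred_exists]
  exact MeasurableSet.iUnion fun n => measurable_pi_apply (X := fun _ => History G) n
    (Policy.measurableSet_terminal_output (G := G) D hC)

namespace Policy

variable [StandardBorelSpace U]

/-- The transition kernels of the run, from the histories up to time `n` to the one at time
`n + 1`. -/
def runKernel (π : Policy G D) (hπ : Measurable π.select) (n : ℕ) :
    Kernel (Finset.Iic n → History G) (History G) :=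
  (π.stepKernel hπ).comap (fun x => x ⟨n, Finset.mem_Iic.2 le_rfl⟩) (measurable_pi_apply _)

instance (π : Policy G D) (hπ : Measurable π.select) (n : ℕ) :
    IsMarkovKernel (π.runKernel hπ n) := by
  unfold runKernel
  infer_instance

/-- This is the Ionescu-Tulcea theorem, `Kernel.traj`, started at the empty history. -/
theorem exists_isRunLaw {π : Policy G D} (hπ : Measurable π.select) :
    ∃ μ : Measure (ℕ → History G), π.IsRunLaw μ := by
  let X : ℕ → Type u := fun _ => History G
  let κ : (n : ℕ) → Kernel ((i : Finset.Iic n) → X i) (X (n + 1)) := π.runKernel hπ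
  have : ∀ n, IsMarkovKernel (κ n) := fun n => inferInstanceAs (IsMarkovKernel (π.runKernel hπ n))
  let x₀ : (i : Finset.Iic 0) → X i := fun _ => History.empty G
  let μ : Measure (ℕ → History G) := Kernel.traj κ 0 x₀
  have hμ : IsProbabilityMeasure μ := inferInstanceAs (IsProbabilityMeasure (Kernel.traj κ 0 x₀))
  refine ⟨μ, hμ, ?_, fun n A B hA hB => ?_⟩
  · have h₀ : μ.map (Preorder.frestrictLe (π := X) 0) = Measure.dirac x₀ := by
      have := Kernel.traj_map_frestrictLe_apply (κ := κ) 0 0 x₀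
      rwa [Kernel.partialTraj_self, Kernel.id_apply] at this
    have hae : ∀ᵐ x ∂(Measure.dirac x₀ : Measure ((i : Finset.Iic 0) → X i)), x = x₀ := by
      rw [ae_dirac_eq]
      rfl
    rw [← h₀] at hae
    filter_upwards [ae_of_ae_map (Preorder.measurable_frestrictLe 0).aemeasurable hae] with ω hω
    exact congrFun hω ⟨0, Finset.mem_Iic.2 le_rfl⟩
  · have h₁ : μ.map (Preorder.frestrictLe (π := X) n) = Kernel.partialTraj κ 0 n x₀ :=
      Kernel.traj_map_frestrictLe_apply (κ := κ) 0 n x₀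
    have h₂ : Kernel.partialTraj κ 0 n x₀ ⊗ₘ κ n =
        μ.map (fun x : (n : ℕ) → X n => (Preorder.frestrictLe n x, x (n + 1))) :=
      Kernel.partialTraj_compProd_eq_map_traj (zero_le (a := n))
    have hmeas : Measurable fun x : (n : ℕ) → X n => (Preorder.frestrictLe n x, x (n + 1)) :=
      (Preorder.measurable_frestrictLe n).prodMk (measurable_pi_apply (n + 1))
    have h₃ := congrArg (fun m => m (A ×ˢ B)) h₂
    rw [Measure.map_apply hmeas (hA.prod hB), ← h₁, Measure.compProd_apply_prod hA hB,
      setLIntegral_map hA ((κ n).measurable_coe hB) (Preorder.measurable_frestrictLe n)] at h₃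
    exact h₃.symm

namespace IsRunLaw

variable {π : Policy G D} {μ ν : Measure (ℕ → History G)}

/-- The condition `next` is this identity on rectangles, which determine a finite measure on a
product. -/
theorem map_prodMk_eq_compProd (hμ : π.IsRunLaw μ) (hπ : Measurable π.select) (n : ℕ) :
    μ.map (fun ω => ((fun i : Finset.Iic n => ω i), ω (n + 1))) =
      μ.map (fun ω (i : Finset.Iic n) => ω i) ⊗ₘ π.runKernel hπ n := by
  have := hμ.isProbabilityMeasure
  have hr : Measurable fun (ω : ℕ → History G) (i : Finset.Iic n) => ω i :=
    measurable_pi_lambda _ fun i => measurable_pi_apply i.1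
  have hp : Measurable fun ω : ℕ → History G => ((fun i : Finset.Iic n => ω i), ω (n + 1)) :=
    hr.prodMk (measurable_pi_apply (n + 1))
  have := Measure.isProbabilityMeasure_map (μ := μ) hr.aemeasurable
  have := Measure.isProbabilityMeasure_map (μ := μ) hp.aemeasurable
  refine Measure.ext_prod fun {A B} hA hB => ?_
  rw [Measure.map_apply hp (hA.prod hB), Measure.compProd_apply_prod hA hB,
    setLIntegral_map hA ((π.runKernel hπ n).measurable_coe hB) hr]
  exact hμ.next n A B hA hB

theorem map_restrict_Iic_eq (hμ : π.IsRunLaw μ) (hν : π.IsRunLaw ν) (hπ : Measurable π.select)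
    (n : ℕ) : μ.map (fun ω (i : Finset.Iic n) => ω i) = ν.map (fun ω (i : Finset.Iic n) => ω i) := by
  induction n with
  | zero =>
    have h {ρ : Measure (ℕ → History G)} (hρ : π.IsRunLaw ρ) :
        ρ.map (fun ω (i : Finset.Iic 0) => ω i) = Measure.dirac fun _ => History.empty G := by
      have := hρ.isProbabilityMeasure
      have hae : (fun ω (i : Finset.Iic 0) => ω i) =ᵐ[ρ] fun _ _ => History.empty G := by
        filter_upwards [hρ.start] with ω hω
        ext1 i
        rw [Nat.le_zero.1 (Finset.mem_Iic.1 i.2), hω]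
      rw [Measure.map_congr hae, Measure.map_const, measure_univ, one_smul]
    rw [h hμ, h hν]
  | succ n ih =>
    let e : (Finset.Iic n → History G) × History G → Finset.Iic (n + 1) → History G :=
      fun p i => if h : i.1 ≤ n then p.1 ⟨i, Finset.mem_Iic.2 h⟩ else p.2
    have he : Measurable e := by
      refine measurable_pi_lambda _ fun i => ?_
      by_cases h : i.1 ≤ n
      · simp only [e, h, dite_true]
        exact (measurable_pi_apply (X := fun _ : Finset.Iic n => History G) _).comp measurable_fst
      · simp only [e, h, dite_false]
        exact measurable_snd
    have hcomp : (fun (ω : ℕ → History G) (i : Finset.Iic (n + 1)) => ω i) =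
        e ∘ fun ω => ((fun i : Finset.Iic n => ω i), ω (n + 1)) := by
      ext1 ω
      ext1 i
      by_cases h : i.1 ≤ n
      · simp [e, h]
      · have : i.1 = n + 1 := le_antisymm (Finset.mem_Iic.1 i.2) (not_le.1 h)
        simp [e, this]
    have hp : Measurable fun ω : ℕ → History G => ((fun i : Finset.Iic n => ω i), ω (n + 1)) :=
      (measurable_pi_lambda _ fun i => measurable_pi_apply i.1).prodMk (measurable_pi_apply (n + 1))
    rw [hcomp, ← Measure.map_map he hp, ← Measure.map_map he hp,
      hμ.map_prodMk_eq_compProd hπ, hν.map_prodMk_eq_compProd hπ, ih]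

/-- Any finite set of times lies in an initial segment, so both laws are projective limits of the
same marginals. -/
theorem unique (hμ : π.IsRunLaw μ) (hν : π.IsRunLaw ν) (hπ : Measurable π.select) : μ = ν := by
  have := hν.isProbabilityMeasure
  have hfin : ∀ s : Finset ℕ, IsFiniteMeasure (ν.map (s.restrict (π := fun _ => History G))) :=
    fun s => inferInstance
  refine IsProjectiveLimit.unique
    (P := fun s : Finset ℕ => ν.map (s.restrict (π := fun _ => History G))) (fun s => ?_)
    (fun s => rfl)
  let e : (Finset.Iic (s.sup id) → History G) → s → History G :=
    fun x i => x ⟨i, Finset.mem_Iic.2 (Finset.le_sup (f := id) i.2)⟩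
  have he : Measurable e := measurable_pi_lambda _ fun i => measurable_pi_apply _
  have hr : Measurable fun (ω : ℕ → History G) (i : Finset.Iic (s.sup id)) => ω i :=
    measurable_pi_lambda _ fun i => measurable_pi_apply i.1
  have hcomp : s.restrict (π := fun _ => History G) = e ∘ fun ω i => ω i := rfl
  show μ.map _ = ν.map _
  rw [hcomp, ← Measure.map_map he hr, ← Measure.map_map he hr, hμ.map_restrict_Iic_eq hν hπ]

theorem lintegral_eval_succ (hμ : π.IsRunLaw μ) (hπ : Measurable π.select) (n : ℕ)
    {f : History G → ENNReal} (hf : Measurable f) :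
    ∫⁻ ω, f (ω (n + 1)) ∂μ = ∫⁻ ω, ∫⁻ h, f h ∂π.step (ω n) ∂μ := by
  have hstep : Measurable fun ω : ℕ → History G => π.step (ω n) :=
    (measurable_step hπ).comp (measurable_pi_apply n)
  have hmap : μ.map (fun ω => ω (n + 1)) = μ.bind fun ω => π.step (ω n) := by
    ext B hB
    rw [Measure.map_apply (measurable_pi_apply (n + 1)) hB, Measure.bind_apply hB hstep.aemeasurable]
    simpa [Set.preimage] using hμ.next n Set.univ B MeasurableSet.univ hB
  rw [← lintegral_map hf (measurable_pi_apply (n + 1)), hmap,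
    Measure.lintegral_bind hstep.aemeasurable hf.aemeasurable]

/-! ### Termination events of the run -/

variable {C : Set (BagInstance I)}

/-- Markov property: one step of the run is traded for one more step in `terminationProb`. The case
`m = 0` gives the probability at time `n`. -/
theorem lintegral_terminationProb (hμ : π.IsRunLaw μ) (hπ : Measurable π.select)
    (hC : MeasurableSet C) (n m : ℕ) :
    ∫⁻ ω, π.terminationProb C m (ω n) ∂μ = π.terminationProb C (m + n) (History.empty G) := by
  induction n generalizing m with
  | zero =>
    have := hμ.isProbabilityMeasure
    rw [lintegral_congr_ae (g := fun _ => π.terminationProb C m (History.empty G))]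
    · simp
    · filter_upwards [hμ.start] with ω hω
      rw [hω]
  | succ n ih =>
    rw [hμ.lintegral_eval_succ hπ n (measurable_terminationProb hπ hC m),
      ← Nat.succ_add_eq_add_succ, ← ih]
    rfl

theorem measure_terminal_output_at (hμ : π.IsRunLaw μ) (hπ : Measurable π.select)
    (hC : MeasurableSet C) (n : ℕ) :
    μ {ω | (ω n).Terminal D ∧ (ω n).output ∈ C} = π.terminationProb C n (History.empty G) := by
  have hm := measurable_pi_apply (X := fun _ => History G) n
    (measurableSet_terminal_output (G := G) D hC)
  rw [← zero_add n, ← hμ.lintegral_terminationProb hπ hC n 0, zero_add]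
  exact (lintegral_indicator_one hm).symm

/-- Absorption is a property of the transition law, so it holds along almost every sequence only:
from such a history the next one has a Dirac law. -/
theorem ae_terminal_output_succ (hμ : π.IsRunLaw μ) (hC : MeasurableSet C) :
    ∀ᵐ ω ∂μ, ∀ n, (ω n).Terminal D ∧ (ω n).output ∈ C →
      (ω (n + 1)).Terminal D ∧ (ω (n + 1)).output ∈ C := by
  refine ae_all_iff.2 fun n => ?_
  have hT := measurableSet_terminal_output (G := G) D hC
  have hA := measurable_pi_apply (X := fun _ : Finset.Iic n => History G)
    ⟨n, Finset.mem_Iic.2 le_rfl⟩ hT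
  have hnext := hμ.next n _ _ hA hT.compl
  rw [ae_iff]
  refine Eq.trans ?_ (hnext.trans ?_)
  · congr 1
    ext ω
    simp only [Set.mem_ofPred_eq, Classical.not_imp, Set.mem_preimage, Set.mem_compl_iff]
  · refine setLIntegral_eq_zero ?_ fun ω hω => ?_
    · exact measurable_pi_apply (X := fun _ => History G) n hT
    · rw [π.step_of_terminal (h := ω n) hω.1, Measure.dirac_apply' _ hT.compl]
      exact Set.indicator_of_notMem (M := ENNReal) (Set.notMem_compl_iff.2 hω) 1

theorem ae_terminal_output_mono (hμ : π.IsRunLaw μ) (hC : MeasurableSet C) :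
    ∀ᵐ ω ∂μ, ∀ m n, m ≤ n → (ω m).Terminal D ∧ (ω m).output ∈ C →
      (ω n).Terminal D ∧ (ω n).output ∈ C := by
  filter_upwards [hμ.ae_terminal_output_succ hC] with ω hω m n hmn hm
  induction n, hmn using Nat.le_induction with
  | base => exact hm
  | succ n _ ih => exact hω n ih

/-- Up to null sets the events at time `n` increase, so their union up to `n` is the last one and
continuity from below applies. -/
theorem measure_terminatesIn (hμ : π.IsRunLaw μ) (hπ : Measurable π.select)
    (hC : MeasurableSet C) :
    μ (terminatesIn G D C) = ⨆ n, π.terminationProb C n (History.empty G) := by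
  rw [terminatesIn, Set.ofPred_exists, measure_iUnion_eq_iSup_accumulate]
  refine iSup_congr fun n => ?_
  rw [← hμ.measure_terminal_output_at hπ hC n]
  refine measure_congr ?_
  filter_upwards [hμ.ae_terminal_output_mono hC] with ω hω
  refine propext (Set.mem_accumulate.trans ⟨?_, fun h => ⟨n, le_rfl, h⟩⟩)
  rintro ⟨m, hm, h⟩
  exact hω m n hm h

/-- The distribution of the output of the run, with the missing mass for nontermination. -/
theorem exists_measure_eq_terminatesIn (hμ : π.IsRunLaw μ) :
    ∃ P : Measure (BagInstance I), ∀ C, MeasurableSet C → P C = μ (terminatesIn G D C) := by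
  refine ⟨Measure.ofMeasurable (fun C _ => μ (terminatesIn G D C)) ?_ ?_, fun C hC =>
    Measure.ofMeasurable_apply C hC⟩
  · simp [terminatesIn]
  · intro C hC hdisj
    have hunion : terminatesIn G D (⋃ i, C i) = ⋃ i, terminatesIn G D (C i) := by
      ext ω
      simp only [terminatesIn, Set.mem_iUnion, Set.mem_ofPred_eq]
      exact ⟨fun ⟨n, h, i, hi⟩ => ⟨i, n, h, hi⟩, fun ⟨i, n, h, hi⟩ => ⟨n, h, i, hi⟩⟩
    rw [hunion]
    -- Disjointness holds only almost everywhere: an arbitrary sequence of histories may be terminal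
    -- at two times with different outputs.
    refine measure_iUnion₀ (fun i j hij => ?_) fun i =>
      (measurableSet_terminatesIn G D (hC i)).nullMeasurableSet
    refine measure_eq_zero_iff_ae_notMem.2 ?_
    filter_upwards [hμ.ae_terminal_output_mono (hC i), hμ.ae_terminal_output_mono (hC j)]
      with ω hi hj
    rintro ⟨⟨m, hm⟩, ⟨n, hn⟩⟩
    exact Set.disjoint_left.1 (hdisj hij) (hi m _ (le_max_left m n) hm).2
      (hj n _ (le_max_right m n) hn).2

end IsRunLaw

end Policy

end

end GDatalog

end

/-! ### The output distribution -/

theorem theorem2 {U : Type*} [MeasurableSpace U] [StandardBorelSpace U]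
    (E I : GDatalog.Schema U) {J : Type*} (Ψ : J → GDatalog.ParamDist U)
    (G : GDatalog.Program E I Ψ) (D : Finset (GDatalog.Fact E)) :
    (∃ π : GDatalog.Policy G D, Measurable π.select) ∧
    ∃! P : Measure (GDatalog.BagInstance I),
      P Set.univ ≤ 1 ∧ (∀ᵐ B ∂P, B.IsSet) ∧
      ∀ π : GDatalog.Policy G D, Measurable π.select →
        Measurable π.step ∧ (∀ h, IsProbabilityMeasure (π.step h)) ∧
        ∃ μ : Measure (ℕ → GDatalog.History G), π.IsRunLaw μ ∧ (∀ ν, π.IsRunLaw ν → ν = μ) ∧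
          ∀ C : Set (GDatalog.BagInstance I), MeasurableSet C →
            MeasurableSet (GDatalog.terminatesIn G D C) ∧
            P C = μ (GDatalog.terminatesIn G D C) := by
  obtain ⟨π₀, hπ₀⟩ := GDatalog.Policy.exists_measurable G D
  obtain ⟨μ₀, hμ₀⟩ := GDatalog.Policy.exists_isRunLaw hπ₀
  obtain ⟨P, hP⟩ := hμ₀.exists_measure_eq_terminatesIn
  refine ⟨⟨π₀, hπ₀⟩, P, ⟨?_, ?_, fun π hπ => ?_⟩, ?_⟩
  · have := hμ₀.isProbabilityMeasure
    rw [hP _ MeasurableSet.univ]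
    exact prob_le_one
  -- An output is the underlying multiset of a `Finset`, so this event is empty, not merely null.
  · have hset : GDatalog.terminatesIn G D {B : GDatalog.BagInstance I | B.IsSet}ᶜ = ∅ :=
      Set.eq_empty_of_forall_notMem fun ω ⟨n, _, hn⟩ => hn (ω n).facts.nodup
    rw [ae_iff]
    refine (hP _ GDatalog.BagInstance.measurableSet_isSet.compl).trans ?_
    rw [hset, measure_empty]
  · obtain ⟨μ, hμ⟩ := GDatalog.Policy.exists_isRunLaw hπ
    refine ⟨GDatalog.Policy.measurable_step hπ, π.isProbabilityMeasure_step, μ, hμ,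
      fun ν hν => hν.unique hμ hπ, fun C hC => ⟨GDatalog.measurableSet_terminatesIn G D hC, ?_⟩⟩
    rw [hP C hC, hμ₀.measure_terminatesIn hπ₀ hC, hμ.measure_terminatesIn hπ hC]
    exact iSup_congr fun n => GDatalog.Policy.terminationProb_eq hπ₀ hπ hC n _
  -- Because a measurable policy exists, the requirement on all policies is not vacuous and fixes
  -- `Q` on every measurable set.
  · rintro Q ⟨-, -, hQ⟩
    obtain ⟨-, -, μ, hμ, -, hQμ⟩ := hQ π₀ hπ₀
    obtain rfl := hμ.unique hμ₀ hπ₀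
    ext C hC
    rw [(hQμ C hC).2, hP C hC]
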